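/- Let $\Gamma = \mathrm{SL}_2(\mathbb{Z})$, let $M_k(\Gamma)$ be the complex vector space of modular forms of weight $k$ for $\Gamma$ (holomorphic functions $F$ on the upper half-plane with $F\left(\frac{a\tau+b}{c\tau+d}\right) = (c\tau+d)^k F(\tau)$ for all $\begin{pmatrix} a & b\\ c & d\end{pmatrix} \in \Gamma$ and with $|F(\tau)|$ bounded as $\operatorname{Im}(\tau)\to\infty$), and let $S_k(\Gamma) \subseteq M_k(\Gamma)$ be the subspace of cusp forms (those with $F(\tau)\to 0$ as $\operatorname{Im}(\tau)\to\infty$). Let $k \ge 0$ be an even integer. Then $$\dim_{\mathbb{C}} M_k(\Gamma) = \begin{cases} \lfloor k/12\rfloor & \text{if } k\equiv 2 \pmod{12},\\ \lfloor k/12\rfloor + 1 & \text{if } k\not\equiv 2 \pmod{12},\end{cases}$$ $$\dim_{\mathbb{C}} S_k(\Gamma) = \begin{cases} 0 & \text{if } k<12,\\ \lfloor k/12\rfloor - 1 & \text{if } k\ge 12,\ k\equiv 2 \pmod{12},\\ \lfloor k/12\rfloor & \text{if } k\ge 12,\ k\not\equiv 2 \pmod{12}.\end{cases}$$ In particular both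 spaces are finite-dimensional. -/

import Mathlib

open scoped MatrixGroups

/-! Division by the discriminant Δ, a weight 12 cusp form with no zeros on the upper half-plane and
a simple zero at infinity, identifies S_k with M_{k-12} (`CuspForm.discriminantEquiv`). So the cusp
form count is `ModularForm.dimension_level_one` in weight k - 12. -/

theorem mainTheorem2 (k : ℕ) (hk : Even k) :
    Module.rank ℂ (ModularForm 𝒮ℒ (k : ℤ)) =
        ((if k ≡ 2 [MOD 12] then k / 12 else k / 12 + 1 : ℕ) : Cardinal) ∧
      Module.rank ℂ (CuspForm 𝒮ℒ (k : ℤ)) =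
        ((if k < 12 then 0 else if k ≡ 2 [MOD 12] then k / 12 - 1 else k / 12 : ℕ) :
          Cardinal) := by
  refine ⟨ModularForm.dimension_level_one k hk, ?_⟩
  by_cases h12 : k < 12
  · simpa [h12] using CuspForm.rank_eq_zero_of_weight_lt_twelve (k := (k : ℤ)) (by lia)
  -- Subtraction in ℕ truncates: this fails at k = 2, so `h12` is essential.
  · have hmod : k - 12 ≡ 2 [MOD 12] ↔ k ≡ 2 [MOD 12] := by
      simp only [Nat.ModEq]
      lia
    rw [CuspForm.discriminantEquiv.rank_eq,
      show (k : ℤ) - 12 = ((k - 12 : ℕ) : ℤ) by lia,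
      ModularForm.dimension_level_one (k - 12) (by grind), Nat.cast_inj]
    simp only [h12, hmod, if_false]
    split_ifs <;> lia
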